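/- Let $\Theta\subseteq\mathbb R$ be an interval, and let $X$ be a random variable whose law, for each $\theta\in\Theta$, has a density (with respect to a fixed dominating measure, e.g. Lebesgue measure for a PDF or counting measure for a PMF) of the form $$f(x;\theta)=h(x)\exp[u(\theta)T(x)-v(\theta)],$$ where $h\ge 0$ and $T$ are measurable real-valued functions and $u,v$ are real-valued differentiable functions on $\Theta$ (with one-sided derivatives at an endpoint that belongs to $\Theta$) such that $v'(\theta)=\theta u'(\theta)$ and $u'(\theta)>0$ for all $\theta\in\Theta$. Let $X_1,X_2,\dots$ be i.i.d. samples of $X$, and let $f_n(x_1,\dots,x_n;\theta)=\prod_{i=1}^n f(x_i;\theta)$ be the likelihood function. Then for every integer $n\ge 1$ and all $x_1,\dots,x_n$ the function $\theta\mapsto f_n(x_1,\dots,x_n;\theta)$ is unimodal on $\Theta$, that is, there is a real number $\theta^*$ (not necessarily in $\Theta$) such that the function is non-decreasing on $\{\theta\in\Theta:\theta\le\theta^*\}$ and non-increasing on $\{\theta\in\Theta:\theta\ge\theta^*\}$. Moreover, for all $\alpha,\beta\in(0,1)$ and all $\theta,\theta',\theta''\in\Theta$ with $\theta'<\theta''$,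 $$\lim_{n\to\infty}\Pr\Bigl\{\beta<\Lambda_n(\theta',\theta'')<\tfrac1\alpha\,\Big|\,\theta\Bigr\}=0,$$ where $\Pr\{\cdot\mid\theta\}$ is the probability when the parameter is $\theta$, $\Lambda_n(\theta',\theta'')$ is the likelihood ratio $f_n(X_1,\dots,X_n;\theta'')/f_n(X_1,\dots,X_n;\theta')$, and the event is read as $\beta f_n(X_1,\dots,X_n;\theta')<f_n(X_1,\dots,X_n;\theta'')<\tfrac1\alpha f_n(X_1,\dots,X_n;\theta')$. -/

import Mathlib

/-- `g` is unimodal on the parameter set `Θ`: for some real number `θstar` (which need not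
belong to `Θ`), `g` is non-decreasing on the points of `Θ` that are at most `θstar` and
non-increasing on the points of `Θ` that are at least `θstar`. -/
def IsUnimodalOn (g : ℝ → ℝ) (Θ : Set ℝ) : Prop :=
  ∃ θstar : ℝ, MonotoneOn g (Θ ∩ Set.Iic θstar) ∧ AntitoneOn g (Θ ∩ Set.Ici θstar)

/-- The exponential-family density `f(x; θ) = h(x) exp[u(θ) T(x) - v(θ)]`. -/
noncomputable def expFamilyDensity {S : Type*} (h T : S → ℝ) (u v : ℝ → ℝ)
    (θ : ℝ) (x : S) : ℝ :=
  h x * Real.exp (u θ * T x - v θ)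

/-- The likelihood `f_n(x₁, …, x_n; θ)` of `n` independent observations with common density
`f(·; θ)`, i.e. the joint density, `∏ i, f(x_i; θ)`. -/
noncomputable def likelihood {S : Type*} (f : ℝ → S → ℝ) {n : ℕ} (x : Fin n → S) (θ : ℝ) : ℝ :=
  ∏ i, f θ (x i)

/-- `lo < Λ < hi` for the likelihood ratio `Λ = f_n(x; θ₂) / f_n(x; θ₁)`, where `Λ ∼ κ` is
read as `f_n(x; θ₂) ∼ κ f_n(x; θ₁)`, so that no division occurs. -/
def LikelihoodRatioBetween {S : Type*} (f : ℝ → S → ℝ) {n : ℕ} (x : Fin n → S)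
    (θ₁ θ₂ lo hi : ℝ) : Prop :=
  lo * likelihood f x θ₁ < likelihood f x θ₂ ∧ likelihood f x θ₂ < hi * likelihood f x θ₁

/-- `X 0, X 1, …` are i.i.d. samples whose common law has density `f` with respect to the
dominating measure `ν`, under the probability measure `P`. -/
structure IsIIDSample {Ω S : Type*} [MeasurableSpace Ω] [MeasurableSpace S]
    (ν : MeasureTheory.Measure S) (f : S → ℝ) (X : ℕ → Ω → S)
    (P : MeasureTheory.Measure Ω) : Prop where
  isProbabilityMeasure : MeasureTheory.IsProbabilityMeasure P
  measurable : ∀ i, Measurable (X i)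
  iIndepFun : ProbabilityTheory.iIndepFun X P
  map_eq : ∀ i, P.map (X i) = ν.withDensity (fun x => ENNReal.ofReal (f x))

/-!
The exponent `u θ * τ - v θ` has derivative `u' θ * (τ - θ)`, so on `Θ` it increases strictly up
to `τ` and decreases strictly afterwards. With `τ` the sample mean of `T` this is the unimodality
of the likelihood. It also shows that `T` is not almost surely constant: if `T = τ` almost surely,
the laws at any two parameters are proportional, hence equal as probability measures, and the
exponent at `τ` would be constant on `Θ`.

The likelihood ratio lies between two positive bounds only if `∑ T (X i)` lies in a window of fixed
length around a deterministic centre. A sum of `n` i.i.d. non-degenerate variables escapes such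
windows without any moment assumption: for a law with characteristic function `φ`, averaging over
Gaussian frequencies bounds the mass of `[-r, r]` by `exp (r ^ 2 / 2) * ∫ ‖φ‖ dγ`. For the recentred
sum `‖φ‖` is the `n`-th power of the modulus for one summand, which is less than `1` off a countable
set, so the bound tends to `0`.
-/

open MeasureTheory ProbabilityTheory Filter
open scoped Topology

section CharFun

theorem integral_charFun_comm {E : Type*} [NormedAddCommGroup E] [InnerProductSpace ℝ E]
    [MeasurableSpace E] [BorelSpace E] [SecondCountableTopology E]
    (μ ν : Measure E) [IsFiniteMeasure μ] [IsFiniteMeasure ν] :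
    ∫ t, charFun μ t ∂ν = ∫ x, charFun ν x ∂μ := by
  have hint : Integrable (fun p : E × E => Complex.exp (inner ℝ p.2 p.1 * Complex.I))
      (ν.prod μ) :=
    Integrable.of_bound (C := 1) (by fun_prop)
      (ae_of_all _ fun p => (Complex.norm_exp_ofReal_mul_I _).le)
  simp only [charFun_apply]
  rw [integral_integral_swap hint]
  simp only [real_inner_comm]

theorem integral_charFun_gaussianReal (μ : Measure ℝ) [IsFiniteMeasure μ] :
    ∫ t, charFun μ t ∂(gaussianReal 0 1) = ((∫ x, Real.exp (-x ^ 2 / 2) ∂μ : ℝ) : ℂ) := by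
  rw [integral_charFun_comm, ← integral_complex_ofReal]
  congr with x
  rw [charFun_gaussianReal]
  push_cast
  congr 1
  simp [neg_div]

theorem integral_exp_neg_sq_div_two_le_integral_norm_charFun (μ : Measure ℝ)
    [IsFiniteMeasure μ] :
    ∫ x, Real.exp (-x ^ 2 / 2) ∂μ ≤ ∫ t, ‖charFun μ t‖ ∂(gaussianReal 0 1) :=
  calc ∫ x, Real.exp (-x ^ 2 / 2) ∂μ
    _ ≤ ‖((∫ x, Real.exp (-x ^ 2 / 2) ∂μ : ℝ) : ℂ)‖ := by
        rw [Complex.norm_real]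
        exact Real.le_norm_self _
    _ ≤ ∫ t, ‖charFun μ t‖ ∂(gaussianReal 0 1) := by
        rw [← integral_charFun_gaussianReal]
        exact norm_integral_le_integral_norm _

theorem measureReal_closedBall_le_integral_norm_charFun (μ : Measure ℝ) [IsFiniteMeasure μ]
    (r : ℝ) :
    μ.real (Metric.closedBall 0 r) ≤
      Real.exp (r ^ 2 / 2) * ∫ t, ‖charFun μ t‖ ∂(gaussianReal 0 1) := by
  have hint : Integrable (fun x => Real.exp (-x ^ 2 / 2)) μ := by
    refine Integrable.of_bound (C := 1) (by fun_prop) (ae_of_all _ fun x => ?_)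
    rw [Real.norm_eq_abs, Real.abs_exp, Real.exp_le_one_iff]
    linarith [sq_nonneg x]
  have hsub : Metric.closedBall 0 r ⊆ {x | Real.exp (-r ^ 2 / 2) ≤ Real.exp (-x ^ 2 / 2)} := by
    intro x hx
    have hx : |x| ≤ r := by simpa using hx
    have hsq : x ^ 2 ≤ r ^ 2 := sq_le_sq' (abs_le.1 hx).1 (abs_le.1 hx).2
    exact Real.exp_le_exp.2 (by linarith)
  calc μ.real (Metric.closedBall 0 r)
    _ = Real.exp (r ^ 2 / 2) * (Real.exp (-r ^ 2 / 2) * μ.real (Metric.closedBall 0 r)) := by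
        rw [← mul_assoc, ← Real.exp_add, neg_div, add_neg_cancel, Real.exp_zero, one_mul]
    _ ≤ Real.exp (r ^ 2 / 2) *
          (Real.exp (-r ^ 2 / 2) * μ.real {x | Real.exp (-r ^ 2 / 2) ≤ Real.exp (-x ^ 2 / 2)}) := by
        gcongr
        exact measure_ne_top _ _
    _ ≤ Real.exp (r ^ 2 / 2) * ∫ x, Real.exp (-x ^ 2 / 2) ∂μ := by
        gcongr
        exact mul_meas_ge_le_integral_of_nonneg (ae_of_all _ fun x => (Real.exp_pos _).le) hint _
    _ ≤ Real.exp (r ^ 2 / 2) * ∫ t, ‖charFun μ t‖ ∂(gaussianReal 0 1) := by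
        gcongr
        exact integral_exp_neg_sq_div_two_le_integral_norm_charFun μ

theorem support_nontrivial_of_ne_dirac {α : Type*} [TopologicalSpace α]
    [HereditarilyLindelofSpace α] [MeasurableSpace α]
    {μ : Measure α} [IsProbabilityMeasure μ] (hμ : ∀ c, μ ≠ Measure.dirac c) :
    μ.support.Nontrivial := by
  obtain ⟨c, hc⟩ := Measure.nonempty_support (IsProbabilityMeasure.ne_zero μ)
  by_contra hnt
  have hconst : id =ᵐ[μ] fun _ => c := by
    filter_upwards [Measure.support_mem_ae (μ := μ)] with x hx
    exact Set.not_nontrivial_iff.1 hnt hx hc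
  apply hμ c
  rw [← Measure.map_id (μ := μ), Measure.map_congr hconst, Measure.map_const, measure_univ,
    one_smul]

theorem countable_setOf_exp_mul_I_eq {a b : ℝ} (hab : a ≠ b) :
    {t : ℝ | Complex.exp (t * a * Complex.I) = Complex.exp (t * b * Complex.I)}.Countable := by
  have hinj : Function.Injective fun t : ℝ => (t : ℂ) * (a - b) * Complex.I := by
    have hab' : (a : ℂ) - b ≠ 0 := sub_ne_zero.2 (mod_cast hab)
    exact (mul_left_injective₀ Complex.I_ne_zero).comp
      ((mul_left_injective₀ hab').comp Complex.ofReal_injective)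
  refine ((Set.countable_singleton (1 : ℂ)).preimage_cexp.preimage hinj).mono fun t ht => ?_
  have ht : Complex.exp (t * a * Complex.I) = Complex.exp (t * b * Complex.I) := ht
  simp [mul_sub, sub_mul, Complex.exp_sub, ht]

theorem countable_setOf_norm_charFun_eq_one {μ : Measure ℝ} [IsProbabilityMeasure μ]
    (hμ : ∀ c, μ ≠ Measure.dirac c) : {t | ‖charFun μ t‖ = 1}.Countable := by
  obtain ⟨a, ha, b, hb, hab⟩ := support_nontrivial_of_ne_dirac hμ
  refine (countable_setOf_exp_mul_I_eq hab).mono fun t ht => ?_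
  -- Equality in the triangle inequality forces `exp (i t x)` to be constant almost everywhere.
  obtain ⟨w, hw⟩ : ∃ w : ℂ, ∀ᵐ x : ℝ ∂μ, Complex.exp (t * x * Complex.I) = w := by
    have hle : ∀ᵐ x : ℝ ∂μ, ‖Complex.exp (t * x * Complex.I)‖ ≤ 1 := ae_of_all _ fun x => by
      rw [← Complex.ofReal_mul, Complex.norm_exp_ofReal_mul_I]
    refine ⟨_, (ae_eq_const_or_norm_integral_lt_of_norm_le_const hle).resolve_right ?_⟩
    rw [← charFun_apply_real, probReal_univ, one_mul]
    exact (Set.mem_ofPred_eq.mp ht).not_lt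
  have hsupp : μ.support ⊆ {x : ℝ | Complex.exp (t * x * Complex.I) = w} :=
    Measure.support_subset_of_isClosed (isClosed_eq (by fun_prop) continuous_const) hw
  exact (hsupp ha).trans (hsupp hb).symm

theorem tendsto_integral_norm_charFun_pow {μ : Measure ℝ} [IsProbabilityMeasure μ]
    (hμ : ∀ c, μ ≠ Measure.dirac c) (γ : Measure ℝ) [IsFiniteMeasure γ] [NullSingletonClass γ] :
    Tendsto (fun n : ℕ => ∫ t, ‖charFun μ t‖ ^ n ∂γ) atTop (𝓝 0) := by
  have hlim : ∀ᵐ t ∂γ, Tendsto (fun n : ℕ => ‖charFun μ t‖ ^ n) atTop (𝓝 0) := by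
    filter_upwards [(countable_setOf_norm_charFun_eq_one hμ).ae_notMem γ] with t ht
    exact tendsto_pow_atTop_nhds_zero_of_lt_one (norm_nonneg _)
      ((norm_charFun_le_one t).lt_of_ne ht)
  rw [← integral_zero ℝ ℝ (μ := γ)]
  refine tendsto_integral_of_dominated_convergence (fun _ => 1)
    (fun n => (measurable_charFun.norm.pow_const n).aestronglyMeasurable) (integrable_const 1)
    (fun n => ae_of_all _ fun t => ?_) hlim
  rw [norm_pow, norm_norm]
  exact pow_le_one₀ (norm_nonneg _) (norm_charFun_le_one t)

end CharFun

section IIDSum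

variable {Ω : Type*} [MeasurableSpace Ω] {P : Measure Ω}

theorem norm_charFun_map_sum_sub_const {ι E : Type*} [Fintype ι] [NormedAddCommGroup E]
    [InnerProductSpace ℝ E] [MeasurableSpace E] [BorelSpace E] [SecondCountableTopology E]
    {Y : ι → Ω → E} {μ : Measure E} (hlaw : ∀ i, HasLaw (Y i) μ P) (hind : iIndepFun Y P)
    (b t : E) :
    ‖charFun (P.map fun ω => ∑ i, Y i ω - b) t‖ = ‖charFun μ t‖ ^ Fintype.card ι := by
  have hY : ∀ i, AEMeasurable (Y i) P := fun i => (hlaw i).aemeasurable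
  have hmap : P.map (fun ω => ∑ i, Y i ω - b) =
      (P.map fun ω => ∑ i, Y i ω).map (· + -b) := by
    rw [AEMeasurable.map_map_of_aemeasurable (by fun_prop) (by fun_prop)]
    simp only [Function.comp_def, sub_eq_add_neg]
  rw [hmap, charFun_map_add_const, norm_mul, Complex.norm_exp_ofReal_mul_I, mul_one,
    hind.charFun_map_fun_sum_eq_prod hY, Finset.prod_apply, norm_prod]
  simp only [(hlaw _).map_eq, Finset.prod_const, Finset.card_univ]

theorem tendsto_measure_sum_sub_mem_of_isBounded {Y : ℕ → Ω → ℝ} {μ : Measure ℝ}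
    (hlaw : ∀ i, HasLaw (Y i) μ P) (hind : iIndepFun Y P) (hμ : ∀ c, μ ≠ Measure.dirac c)
    (b : ℕ → ℝ) {K : Set ℝ} (hK : Bornology.IsBounded K) :
    Tendsto (fun n : ℕ => P {ω | ∑ i : Fin n, Y i ω - b n ∈ K}) atTop (𝓝 0) := by
  have : IsProbabilityMeasure P := hind.isProbabilityMeasure
  have : IsProbabilityMeasure μ := (hlaw 0).isProbabilityMeasure_iff.1 this
  have : NullSingletonClass (gaussianReal 0 1) := nullSingletonClass_gaussianReal one_ne_zero
  obtain ⟨r, hr⟩ := hK.subset_closedBall 0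
  have hY : ∀ i, AEMeasurable (Y i) P := fun i => (hlaw i).aemeasurable
  have hbound (n : ℕ) : P.real {ω | ∑ i : Fin n, Y i ω - b n ∈ K} ≤
      Real.exp (r ^ 2 / 2) * ∫ t, ‖charFun μ t‖ ^ n ∂(gaussianReal 0 1) :=
    calc P.real {ω | ∑ i : Fin n, Y i ω - b n ∈ K}
      _ ≤ P.real ((fun ω => ∑ i : Fin n, Y i ω - b n) ⁻¹' Metric.closedBall 0 r) :=
          measureReal_mono fun ω hω => hr hω
      _ = (P.map fun ω => ∑ i : Fin n, Y i ω - b n).real (Metric.closedBall 0 r) :=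
          (map_measureReal_apply_of_aemeasurable (by fun_prop) measurableSet_closedBall).symm
      _ ≤ _ := measureReal_closedBall_le_integral_norm_charFun _ r
      _ = _ := by
          simp only [norm_charFun_map_sum_sub_const (fun i : Fin n => hlaw i)
            (hind.precomp Fin.val_injective), Fintype.card_fin]
  have hlim := (tendsto_integral_norm_charFun_pow hμ (gaussianReal 0 1)).const_mul
    (Real.exp (r ^ 2 / 2))
  rw [mul_zero] at hlim
  rw [← ENNReal.tendsto_toReal_iff (fun n => measure_ne_top _ _) ENNReal.zero_ne_top]
  exact squeeze_zero (fun n => measureReal_nonneg) hbound hlim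

end IIDSum

section Unimodal

theorem IsUnimodalOn.monotone_comp {g F : ℝ → ℝ} {Θ : Set ℝ} (hg : IsUnimodalOn g Θ)
    (hF : Monotone F) : IsUnimodalOn (fun θ => F (g θ)) Θ := by
  obtain ⟨θstar, hmono, hanti⟩ := hg
  exact ⟨θstar, hF.comp_monotoneOn hmono, hF.comp_antitoneOn hanti⟩

theorem strictMonoOn_of_forall_hasDerivWithinAt_pos {D : Set ℝ} (hD : Convex ℝ D) {g g' : ℝ → ℝ}
    (hg : ∀ x ∈ D, HasDerivWithinAt g (g' x) D x) (hg' : ∀ x ∈ interior D, 0 < g' x) :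
    StrictMonoOn g D :=
  strictMonoOn_of_hasDerivWithinAt_pos hD (fun x hx => (hg x hx).continuousWithinAt)
    (fun x hx => (hg x (interior_subset hx)).mono interior_subset) hg'

theorem strictAntiOn_of_forall_hasDerivWithinAt_neg {D : Set ℝ} (hD : Convex ℝ D) {g g' : ℝ → ℝ}
    (hg : ∀ x ∈ D, HasDerivWithinAt g (g' x) D x) (hg' : ∀ x ∈ interior D, g' x < 0) :
    StrictAntiOn g D :=
  strictAntiOn_of_hasDerivWithinAt_neg hD (fun x hx => (hg x hx).continuousWithinAt)
    (fun x hx => (hg x (interior_subset hx)).mono interior_subset) hg'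

theorem hasDerivWithinAt_exponent {Θ : Set ℝ} {u v : ℝ → ℝ} {θ d : ℝ}
    (hu : HasDerivWithinAt u d Θ θ) (hv : HasDerivWithinAt v (θ * d) Θ θ) (τ : ℝ) :
    HasDerivWithinAt (fun θ => u θ * τ - v θ) (d * (τ - θ)) Θ θ :=
  ((hu.mul_const τ).sub hv).congr_deriv (by ring)

variable {Θ : Set ℝ} (hΘ : Θ.OrdConnected) {u v u' : ℝ → ℝ}
  (hu : ∀ θ ∈ Θ, HasDerivWithinAt u (u' θ) Θ θ)
  (hv : ∀ θ ∈ Θ, HasDerivWithinAt v (θ * u' θ) Θ θ) (hu' : ∀ θ ∈ Θ, 0 < u' θ)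

include hΘ hu hv hu'

theorem strictMonoOn_exponent (τ : ℝ) :
    StrictMonoOn (fun θ => u θ * τ - v θ) (Θ ∩ Set.Iic τ) := by
  refine strictMonoOn_of_forall_hasDerivWithinAt_pos (hΘ.inter Set.ordConnected_Iic).convex
    (fun θ hθ => (hasDerivWithinAt_exponent (hu θ hθ.1) (hv θ hθ.1) τ).mono Set.inter_subset_left)
    fun θ hθ => ?_
  rw [interior_inter, interior_Iic] at hθ
  exact mul_pos (hu' θ (interior_subset hθ.1)) (sub_pos.2 hθ.2)

theorem strictAntiOn_exponent (τ : ℝ) :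
    StrictAntiOn (fun θ => u θ * τ - v θ) (Θ ∩ Set.Ici τ) := by
  refine strictAntiOn_of_forall_hasDerivWithinAt_neg (hΘ.inter Set.ordConnected_Ici).convex
    (fun θ hθ => (hasDerivWithinAt_exponent (hu θ hθ.1) (hv θ hθ.1) τ).mono Set.inter_subset_left)
    fun θ hθ => ?_
  rw [interior_inter, interior_Ici] at hθ
  exact mul_neg_of_pos_of_neg (hu' θ (interior_subset hθ.1)) (sub_neg.2 hθ.2)

theorem exists_exponent_ne (hΘ_nontrivial : Θ.Nontrivial) (τ c : ℝ) :
    ∃ η ∈ Θ, u η * τ - v η ≠ c := by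
  by_contra! hconst
  obtain ⟨a, ha, b, hb, hab⟩ := hΘ_nontrivial.exists_lt
  obtain ⟨m, ham, hmb⟩ := exists_between hab
  have hm : m ∈ Θ := hΘ.out ha hb ⟨ham.le, hmb.le⟩
  rcases le_total m τ with hmτ | hτm
  · have hlt := strictMonoOn_exponent hΘ hu hv hu' τ ⟨ha, ham.le.trans hmτ⟩ ⟨hm, hmτ⟩ ham
    exact hlt.ne ((hconst a ha).trans (hconst m hm).symm)
  · have hlt := strictAntiOn_exponent hΘ hu hv hu' τ ⟨hm, hτm⟩ ⟨hb, hτm.trans hmb.le⟩ hmb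
    exact hlt.ne ((hconst b hb).trans (hconst m hm).symm)

end Unimodal

section Likelihood

variable {S : Type*} {h T : S → ℝ} {u v : ℝ → ℝ} {n : ℕ}

theorem likelihood_expFamilyDensity (h T : S → ℝ) (u v : ℝ → ℝ) (x : Fin n → S) (θ : ℝ) :
    likelihood (expFamilyDensity h T u v) x θ =
      (∏ i, h (x i)) * Real.exp (u θ * ∑ i, T (x i) - n * v θ) := by
  simp only [likelihood, expFamilyDensity, Finset.prod_mul_distrib, ← Real.exp_sum,
    Finset.sum_sub_distrib, ← Finset.mul_sum, Finset.sum_const, Finset.card_univ,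
    Fintype.card_fin, nsmul_eq_mul]

theorem isUnimodalOn_likelihood_expFamilyDensity (hh_nonneg : ∀ x, 0 ≤ h x) {Θ : Set ℝ}
    (hΘ : Θ.OrdConnected) {u' : ℝ → ℝ} (hu : ∀ θ ∈ Θ, HasDerivWithinAt u (u' θ) Θ θ)
    (hv : ∀ θ ∈ Θ, HasDerivWithinAt v (θ * u' θ) Θ θ) (hu' : ∀ θ ∈ Θ, 0 < u' θ)
    (hn : 0 < n) (x : Fin n → S) :
    IsUnimodalOn (fun θ => likelihood (expFamilyDensity h T u v) x θ) Θ := by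
  set τ := (∑ i, T (x i)) / n
  have hexponent : IsUnimodalOn (fun θ => u θ * τ - v θ) Θ :=
    ⟨τ, (strictMonoOn_exponent hΘ hu hv hu' τ).monotoneOn,
      (strictAntiOn_exponent hΘ hu hv hu' τ).antitoneOn⟩
  have hmono : Monotone fun y : ℝ => (∏ i, h (x i)) * Real.exp (n * y) := fun y z hyz => by
    have hH : 0 ≤ ∏ i, h (x i) := Finset.prod_nonneg fun i _ => hh_nonneg _
    dsimp only
    gcongr
  have hsum : ∑ i, T (x i) = n * τ := by
    simp only [τ]
    field_simp
  convert hexponent.monotone_comp hmono using 2 with θ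
  rw [likelihood_expFamilyDensity, hsum]
  ring_nf

theorem LikelihoodRatioBetween.exp_mem_Ioo (hh_nonneg : ∀ x, 0 ≤ h x) {x : Fin n → S}
    {θ₁ θ₂ lo hi : ℝ}
    (hx : LikelihoodRatioBetween (expFamilyDensity h T u v) x θ₁ θ₂ lo hi) :
    Real.exp ((u θ₂ - u θ₁) * ∑ i, T (x i) - n * (v θ₂ - v θ₁)) ∈ Set.Ioo lo hi := by
  obtain ⟨hlo, hhi⟩ := hx
  simp only [likelihood_expFamilyDensity, mul_left_comm _ (∏ i, h (x i))] at hlo hhi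
  have hH : 0 ≤ ∏ i, h (x i) := Finset.prod_nonneg fun i _ => hh_nonneg _
  have hsub : (u θ₂ - u θ₁) * ∑ i, T (x i) - n * (v θ₂ - v θ₁) =
      (u θ₂ * ∑ i, T (x i) - n * v θ₂) - (u θ₁ * ∑ i, T (x i) - n * v θ₁) := by ring
  rw [hsub, Real.exp_sub]
  exact ⟨(lt_div_iff₀ (Real.exp_pos _)).2 (lt_of_mul_lt_mul_left hlo hH),
    (div_lt_iff₀ (Real.exp_pos _)).2 (lt_of_mul_lt_mul_left hhi hH)⟩

theorem LikelihoodRatioBetween.sum_sub_mem_Ioo (hh_nonneg : ∀ x, 0 ≤ h x) {x : Fin n → S}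
    {θ₁ θ₂ lo hi : ℝ}
    (hx : LikelihoodRatioBetween (expFamilyDensity h T u v) x θ₁ θ₂ lo hi)
    (hu : u θ₁ < u θ₂) (hlo : 0 < lo) :
    ∑ i, T (x i) - n * ((v θ₂ - v θ₁) / (u θ₂ - u θ₁)) ∈
      Set.Ioo (Real.log lo / (u θ₂ - u θ₁)) (Real.log hi / (u θ₂ - u θ₁)) := by
  obtain ⟨hgt, hlt⟩ := hx.exp_mem_Ioo hh_nonneg
  have hδ : 0 < u θ₂ - u θ₁ := sub_pos.2 hu
  have hscale : (∑ i, T (x i) - n * ((v θ₂ - v θ₁) / (u θ₂ - u θ₁))) * (u θ₂ - u θ₁) =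
      (u θ₂ - u θ₁) * ∑ i, T (x i) - n * (v θ₂ - v θ₁) := by
    field_simp
  rw [Set.mem_Ioo, div_lt_iff₀ hδ, lt_div_iff₀ hδ, hscale]
  exact ⟨(Real.log_lt_iff_lt_exp hlo).2 hgt,
    (Real.lt_log_iff_exp_lt ((Real.exp_pos _).trans hlt)).2 hlt⟩

theorem tendsto_measure_likelihoodRatioBetween {Ω : Type*} [MeasurableSpace Ω]
    [MeasurableSpace S] {μ : Measure S} {P : Measure Ω} {X : ℕ → Ω → S}
    (hlaw : ∀ i, HasLaw (X i) μ P) (hind : iIndepFun X P)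
    (hT : Measurable T) (hT_ne : ∀ τ, μ.map T ≠ Measure.dirac τ) (hh_nonneg : ∀ x, 0 ≤ h x)
    {θ₁ θ₂ : ℝ} (hu : u θ₁ < u θ₂) {lo : ℝ} (hlo : 0 < lo) (hi : ℝ) :
    Tendsto (fun n : ℕ => P {ω | LikelihoodRatioBetween (expFamilyDensity h T u v)
      (fun i : Fin n => X i ω) θ₁ θ₂ lo hi}) atTop (𝓝 0) := by
  have hlawT (i : ℕ) : HasLaw (fun ω => T (X i ω)) (μ.map T) P :=
    (hT.measurePreserving μ).fun_comp_hasLaw (hlaw i)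
  have hindT : iIndepFun (fun i ω => T (X i ω)) P := hind.comp (fun _ => T) fun _ => hT
  have hlim := tendsto_measure_sum_sub_mem_of_isBounded hlawT hindT hT_ne
    (fun n => n * ((v θ₂ - v θ₁) / (u θ₂ - u θ₁)))
    (Metric.isBounded_Ioo (Real.log lo / (u θ₂ - u θ₁)) (Real.log hi / (u θ₂ - u θ₁)))
  exact tendsto_of_tendsto_of_tendsto_of_le_of_le tendsto_const_nhds hlim (fun _ => zero_le)
    fun n => measure_mono fun ω hω => hω.sum_sub_mem_Ioo hh_nonneg hu hlo

end Likelihood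

section ExpFamilyMeasure

variable {S : Type*} [MeasurableSpace S]

/-- The law of one observation at parameter `θ`: the measure with density `f(·; θ)` with respect
to `ν`. It is a probability measure only when `v` is the correct normalization. -/
noncomputable def expFamilyMeasure (ν : Measure S) (h T : S → ℝ) (u v : ℝ → ℝ) (θ : ℝ) :
    Measure S :=
  ν.withDensity fun x => ENNReal.ofReal (expFamilyDensity h T u v θ x)

theorem IsIIDSample.hasLaw {Ω : Type*} [MeasurableSpace Ω] {ν : Measure S} {f : S → ℝ}
    {X : ℕ → Ω → S} {P : Measure Ω} (hX : IsIIDSample ν f X P) (i : ℕ) :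
    HasLaw (X i) (ν.withDensity fun x => ENNReal.ofReal (f x)) P :=
  ⟨(hX.measurable i).aemeasurable, hX.map_eq i⟩

variable {ν : Measure S} {h T : S → ℝ} {u v : ℝ → ℝ}

theorem expFamilyMeasure_eq_withDensity (hh : Measurable h) (hT : Measurable T) (θ η : ℝ) :
    expFamilyMeasure ν h T u v η = (expFamilyMeasure ν h T u v θ).withDensity fun x =>
      ENNReal.ofReal (Real.exp ((u η * T x - v η) - (u θ * T x - v θ))) := by
  unfold expFamilyMeasure expFamilyDensity
  rw [← withDensity_mul _ (by fun_prop) (by fun_prop)]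
  congr with x
  rw [Pi.mul_apply, ← ENNReal.ofReal_mul' (Real.exp_pos _).le, mul_assoc, ← Real.exp_add,
    add_sub_cancel]

theorem exponent_eq_of_map_expFamilyMeasure_eq_dirac (hh : Measurable h) (hT : Measurable T)
    {θ η τ : ℝ} [IsProbabilityMeasure (expFamilyMeasure ν h T u v θ)]
    [IsProbabilityMeasure (expFamilyMeasure ν h T u v η)]
    (hτ : (expFamilyMeasure ν h T u v θ).map T = Measure.dirac τ) :
    u η * τ - v η = u θ * τ - v θ := by
  have hTτ : ∀ᵐ x ∂(expFamilyMeasure ν h T u v θ), T x = τ := by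
    refine ae_of_ae_map hT.aemeasurable (p := fun y => y = τ) ?_
    rw [hτ, ae_dirac_eq]
    exact Filter.eventually_pure.2 rfl
  have hsmul : expFamilyMeasure ν h T u v η =
      ENNReal.ofReal (Real.exp ((u η * τ - v η) - (u θ * τ - v θ))) •
        expFamilyMeasure ν h T u v θ := by
    rw [expFamilyMeasure_eq_withDensity hh hT θ η, ← withDensity_const]
    refine withDensity_congr_ae ?_
    filter_upwards [hTτ] with x hx
    rw [hx]
  have hmass : ENNReal.ofReal (Real.exp ((u η * τ - v η) - (u θ * τ - v θ))) = 1 := by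
    simpa [eq_comm] using congrArg (fun μ : Measure S => μ Set.univ) hsmul
  rw [ENNReal.ofReal_eq_one, Real.exp_eq_one_iff] at hmass
  exact sub_eq_zero.1 hmass

theorem map_expFamilyMeasure_ne_dirac (hh : Measurable h) (hT : Measurable T) {Θ : Set ℝ}
    (hΘ : Θ.OrdConnected) (hΘ_nontrivial : Θ.Nontrivial) {u' : ℝ → ℝ}
    (hu : ∀ θ ∈ Θ, HasDerivWithinAt u (u' θ) Θ θ)
    (hv : ∀ θ ∈ Θ, HasDerivWithinAt v (θ * u' θ) Θ θ) (hu' : ∀ θ ∈ Θ, 0 < u' θ)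
    (hprob : ∀ θ ∈ Θ, IsProbabilityMeasure (expFamilyMeasure ν h T u v θ))
    {θ : ℝ} (hθ : θ ∈ Θ) (τ : ℝ) :
    (expFamilyMeasure ν h T u v θ).map T ≠ Measure.dirac τ := by
  intro hτ
  obtain ⟨η, hη, hne⟩ := exists_exponent_ne hΘ hu hv hu' hΘ_nontrivial τ (u θ * τ - v θ)
  have := hprob θ hθ
  have := hprob η hη
  exact hne (exponent_eq_of_map_expFamilyMeasure_eq_dirac hh hT hτ)

end ExpFamilyMeasure

theorem theorem8 {Ω S : Type*} [MeasurableSpace Ω] [MeasurableSpace S]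
    (ν : MeasureTheory.Measure S)
    (h T : S → ℝ) (hh : Measurable h) (hT : Measurable T) (hh_nonneg : ∀ x, 0 ≤ h x)
    (Θ : Set ℝ) (hΘ : Θ.OrdConnected)
    (u v u' : ℝ → ℝ)
    (hu : ∀ θ ∈ Θ, HasDerivWithinAt u (u' θ) Θ θ)
    (hv : ∀ θ ∈ Θ, HasDerivWithinAt v (θ * u' θ) Θ θ)
    (hu' : ∀ θ ∈ Θ, 0 < u' θ)
    (P : ℝ → MeasureTheory.Measure Ω) (X : ℕ → Ω → S)
    (hX : ∀ θ ∈ Θ, IsIIDSample ν (expFamilyDensity h T u v θ) X (P θ)) :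
    (∀ n : ℕ, 0 < n → ∀ x : Fin n → S,
      IsUnimodalOn (fun θ => likelihood (expFamilyDensity h T u v) x θ) Θ) ∧
    (∀ α ∈ Set.Ioo (0 : ℝ) 1, ∀ β ∈ Set.Ioo (0 : ℝ) 1,
      ∀ θ ∈ Θ, ∀ θ₁ ∈ Θ, ∀ θ₂ ∈ Θ, θ₁ < θ₂ →
      Filter.Tendsto
        (fun n : ℕ => P θ {ω | LikelihoodRatioBetween (expFamilyDensity h T u v)
          (fun i : Fin n => X i ω) θ₁ θ₂ β (1 / α)})
        Filter.atTop (nhds 0)) := by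
  refine ⟨fun n hn x => isUnimodalOn_likelihood_expFamilyDensity hh_nonneg hΘ hu hv hu' hn x, ?_⟩
  intro α _ β hβ θ hθ θ₁ hθ₁ θ₂ hθ₂ hlt
  have hlaw (η : ℝ) (hη : η ∈ Θ) (i : ℕ) : HasLaw (X i) (expFamilyMeasure ν h T u v η) (P η) :=
    (hX η hη).hasLaw i
  have hprob (η : ℝ) (hη : η ∈ Θ) : IsProbabilityMeasure (expFamilyMeasure ν h T u v η) :=
    (hlaw η hη 0).isProbabilityMeasure_iff.1 (hX η hη).isProbabilityMeasure
  have hT_ne (τ : ℝ) : (expFamilyMeasure ν h T u v θ).map T ≠ Measure.dirac τ :=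
    map_expFamilyMeasure_ne_dirac hh hT hΘ ⟨θ₁, hθ₁, θ₂, hθ₂, hlt.ne⟩ hu hv hu' hprob hθ τ
  have hu_mono : StrictMonoOn u Θ := strictMonoOn_of_forall_hasDerivWithinAt_pos hΘ.convex hu
    fun η hη => hu' η (interior_subset hη)
  exact tendsto_measure_likelihoodRatioBetween (hlaw θ hθ) (hX θ hθ).iIndepFun hT hT_ne hh_nonneg
    (hu_mono hθ₁ hθ₂ hlt) hβ.1 (1 / α)
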